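/- Let $k$ be a commutative ring, $R$ a $k$-algebra, $A$ an $R$-ring (a monoid in the category of $R$-$R$-bimodules; equivalently a $k$-algebra with an algebra map $\eta_A:R\to A$), with multiplication $\mu_A$, and $\mathcal C$ an $R$-coring with coproduct $\Delta$ and counit $\varepsilon$. Let $(A,\mathcal C,\psi)_R$ be a bijective right entwining structure over $R$, that is, $\psi:\mathcal C\otimes_R A\to A\otimes_R\mathcal C$ is a bijective $R$-$R$-bilinear map with $\psi\circ(\mathcal C\otimes_R\mu_A)=(\mu_A\otimes_R\mathcal C)(A\otimes_R\psi)(\psi\otimes_R A)$, $\psi\circ(\mathcal C\otimes_R\eta_A)=\eta_A\otimes_R\mathcal C$, $(A\otimes_R\Delta)\circ\psi=(\psi\otimes_R\mathcal C)(\mathcal C\otimes_R\psi)(\Delta\otimes_R A)$ and $(A\otimes_R\varepsilon)\circ\psi=\varepsilon\otimes_R A$. Let $e\in\mathcal C$ be grouplike ($\Delta(e)=e\otimes_R e$, $\varepsilon(e)=1_R$), let $\varrho(a)=\psi(e\otimes_R a)$ and $\lambda(a)=\psi^{-1}(a\otimes_R e)$ be the induced right and left $\mathcal C$-coactions on $A$,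 and let $B=\{b\in A\mid \varrho(b)=b\otimes_R e\}$ be the $k$-subalgebra of coinvariants (so $B\subseteq A$ is the entwined extension given by $e$). Let $T$ be a $k$-subalgebra of $B$. Assume that there exists a strong $T$-connection, i.e. a map $\ell_T:\mathcal C\to A\otimes_T A$ which is a morphism of right $\mathcal C$-comodules (with coaction $A\otimes_T\varrho$ on $A\otimes_TA$) and of left $\mathcal C$-comodules (with coaction $\lambda\otimes_T A$), such that applying $a\otimes_T a'\mapsto a\,\varrho(a')$ to $\ell_T(c)$ gives $1_A\otimes_R c$ for all $c\in\mathcal C$. (1) If $A$ is flat as a left $T$-module, $B$ is flat as a right $T$-module, and $B$ is a direct summand of $A$ as a left $T$-module, then $B$ is a direct summand of $A$ as a left $B$-module. (2) If $A$ is flat as a right $T$-module, $B$ is flat as a left $T$-module, and $B$ is a direct summand of $A$ as a right $T$-module, then $B$ is a direct summand of $A$ as a right $B$-module. (Direct summand means that the submodule $B\subseteq A$ has a complementary submodule, i.e. the inclusion $B\to A$ splits.) -/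

import Mathlib

open MulOpposite Function

universe u v w x

noncomputable section

namespace EntwinedExt

/-! ### Tensor products over a non-commutative ring

Left `R`-modules are `Module R M`; right `R`-modules are `Module Rᵐᵒᵖ M`, so that `m r` is
written `op r • m`. -/

section Tensor

/-- The subgroup of `M ⊗[ℤ] N` generated by the elements `m r ⊗ n - m ⊗ r n`. -/
def balanceRel (R M N : Type*) [Ring R] [AddCommGroup M] [AddCommGroup N]
    [Module Rᵐᵒᵖ M] [Module R N] : AddSubgroup (TensorProduct ℤ M N) :=
  AddSubgroup.closure {z | ∃ (m : M) (r : R) (n : N),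
    z = TensorProduct.tmul ℤ (op r • m) n - TensorProduct.tmul ℤ m (r • n)}

/-- The tensor product `M ⊗_R N` (an abelian group) of a right `R`-module `M` and a left
`R`-module `N` over a not necessarily commutative ring `R`. -/
def BTensor (R M N : Type*) [Ring R] [AddCommGroup M] [AddCommGroup N]
    [Module Rᵐᵒᵖ M] [Module R N] : Type _ :=
  TensorProduct ℤ M N ⧸ balanceRel R M N

namespace BTensor

instance instAddCommGroup (R M N : Type*) [Ring R] [AddCommGroup M] [AddCommGroup N]
    [Module Rᵐᵒᵖ M] [Module R N] : AddCommGroup (BTensor R M N) :=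
  inferInstanceAs (AddCommGroup (TensorProduct ℤ M N ⧸ balanceRel R M N))

variable {R S M N P Q M' N' : Type*} [Ring R] [Ring S]
  [AddCommGroup M] [AddCommGroup N] [AddCommGroup P] [AddCommGroup Q]
  [AddCommGroup M'] [AddCommGroup N']
  [Module Rᵐᵒᵖ M] [Module R N] [Module Rᵐᵒᵖ M'] [Module R N']

variable (R M N) in
/-- The projection from the tensor product over `ℤ`. -/
def mk : TensorProduct ℤ M N →+ BTensor R M N :=
  QuotientAddGroup.mk' (balanceRel R M N)

variable (R) in
/-- The elementary tensor `m ⊗_R n`. -/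
def tmul (m : M) (n : N) : BTensor R M N := mk R M N (TensorProduct.tmul ℤ m n)

theorem add_tmul (m m' : M) (n : N) : tmul R (m + m') n = tmul R m n + tmul R m' n := by
  rw [tmul, TensorProduct.add_tmul, map_add]; rfl

theorem tmul_add (m : M) (n n' : N) : tmul R m (n + n') = tmul R m n + tmul R m n' := by
  rw [tmul, TensorProduct.tmul_add, map_add]; rfl

theorem zero_tmul (n : N) : tmul R (0 : M) n = 0 := by
  rw [tmul, TensorProduct.zero_tmul, map_zero]

theorem tmul_zero (m : M) : tmul R m (0 : N) = 0 := by
  rw [tmul, TensorProduct.tmul_zero, map_zero]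

theorem smul_tmul (m : M) (r : R) (n : N) : tmul R (op r • m) n = tmul R m (r • n) := by
  refine (QuotientAddGroup.eq_iff_sub_mem).2 ?_
  exact AddSubgroup.subset_closure ⟨m, r, n, rfl⟩

/-- A balanced biadditive map induces an additive map on the tensor product. -/
def lift (f : M →+ N →+ P) (h : ∀ m (r : R) n, f (op r • m) n = f m (r • n)) :
    BTensor R M N →+ P :=
  QuotientAddGroup.lift (balanceRel R M N)
    (TensorProduct.liftAddHom f (fun z m n => by simp)) (by
      rw [balanceRel, AddSubgroup.closure_le]
      rintro _ ⟨m, r, n, rfl⟩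
      simp [h])

@[simp] theorem lift_tmul (f : M →+ N →+ P) (h : ∀ m (r : R) n, f (op r • m) n = f m (r • n))
    (m : M) (n : N) : lift f h (tmul R m n) = f m n := rfl

theorem induction_on {p : BTensor R M N → Prop} (x : BTensor R M N)
    (tm : ∀ m n, p (tmul R m n)) (add : ∀ x y, p x → p y → p (x + y)) : p x := by
  obtain ⟨z, rfl⟩ := QuotientAddGroup.mk'_surjective (balanceRel R M N) x
  induction z using TensorProduct.induction_on with
  | zero =>
    have h := tm 0 0
    rwa [zero_tmul] at h
  | tmul m n => exact tm m n
  | add x y hx hy => rw [map_add]; exact add _ _ hx hy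

theorem hom_ext {f g : BTensor R M N →+ P} (h : ∀ m n, f (tmul R m n) = g (tmul R m n)) :
    f = g := by
  ext x
  induction x using induction_on with
  | tm m n => exact h m n
  | add x y hx hy => rw [map_add, map_add, hx, hy]

/-- The map `f ⊗_R g` for a right linear `f` and a left linear `g`. -/
def map (f : M →ₗ[Rᵐᵒᵖ] M') (g : N →ₗ[R] N') : BTensor R M N →+ BTensor R M' N' :=
  lift
    { toFun := fun m =>
        { toFun := fun n => tmul R (f m) (g n)
          map_zero' := by rw [map_zero, tmul_zero]
          map_add' := fun n n' => by rw [map_add, tmul_add] }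
      map_zero' := by ext n; simp [zero_tmul]
      map_add' := fun m m' => by ext n; simp [add_tmul] }
    (fun m r n => by simp [smul_tmul])

@[simp] theorem map_tmul (f : M →ₗ[Rᵐᵒᵖ] M') (g : N →ₗ[R] N') (m : M) (n : N) :
    map f g (tmul R m n) = tmul R (f m) (g n) := rfl

/-- The left `S`-module structure `s (m ⊗ n) = (s m) ⊗ n` for an `S`-`R`-bimodule `M`. -/
instance leftModule [Module S M] [SMulCommClass S Rᵐᵒᵖ M] : Module S (BTensor R M N) where
  smul s x := map { toFun := fun m => s • m
                    map_add' := smul_add s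
                    map_smul' := fun r m => smul_comm s r m } LinearMap.id x
  one_smul x := by
    change map _ _ x = x
    induction x using induction_on with
    | tm m n => simp
    | add x y hx hy => rw [map_add, hx, hy]
  mul_smul s t x := by
    change map _ _ x = map _ _ (map _ _ x)
    induction x using induction_on with
    | tm m n => simp [mul_smul]
    | add x y hx hy => rw [map_add, map_add, map_add, hx, hy]
  smul_zero s := map_zero _
  smul_add s x y := map_add _ x y
  add_smul s t x := by
    change map _ _ x = map _ _ x + map _ _ x
    induction x using induction_on with
    | tm m n => simp [add_smul, add_tmul]
    | add x y hx hy => rw [map_add, map_add, map_add, hx, hy]; abel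
  zero_smul x := by
    change map _ _ x = 0
    induction x using induction_on with
    | tm m n => simp [zero_tmul]
    | add x y hx hy => rw [map_add, hx, hy, add_zero]

theorem smul_tmul_left [Module S M] [SMulCommClass S Rᵐᵒᵖ M] (s : S) (m : M) (n : N) :
    s • tmul R m n = tmul R (s • m) n := rfl

/-- The right `S`-module structure `(m ⊗ n) s = m ⊗ (n s)` for an `R`-`S`-bimodule `N`. -/
instance rightModule [Module Sᵐᵒᵖ N] [SMulCommClass R Sᵐᵒᵖ N] :
    Module Sᵐᵒᵖ (BTensor R M N) where
  smul s x := map LinearMap.id { toFun := fun n => s • n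
                                 map_add' := smul_add s
                                 map_smul' := fun r n => (smul_comm r s n).symm } x
  one_smul x := by
    change map _ _ x = x
    induction x using induction_on with
    | tm m n => simp
    | add x y hx hy => rw [map_add, hx, hy]
  mul_smul s t x := by
    change map _ _ x = map _ _ (map _ _ x)
    induction x using induction_on with
    | tm m n => simp [mul_smul]
    | add x y hx hy => rw [map_add, map_add, map_add, hx, hy]
  smul_zero s := map_zero _
  smul_add s x y := map_add _ x y
  add_smul s t x := by
    change map _ _ x = map _ _ x + map _ _ x
    induction x using induction_on with
    | tm m n => simp [add_smul, tmul_add]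
    | add x y hx hy => rw [map_add, map_add, map_add, hx, hy]; abel
  zero_smul x := by
    change map _ _ x = 0
    induction x using induction_on with
    | tm m n => simp [tmul_zero]
    | add x y hx hy => rw [map_add, hx, hy, add_zero]

theorem smul_tmul_right [Module Sᵐᵒᵖ N] [SMulCommClass R Sᵐᵒᵖ N] (s : Sᵐᵒᵖ) (m : M) (n : N) :
    s • tmul R m n = tmul R m (s • n) := rfl

instance smulCommClass {S' : Type*} [Ring S'] [Module S M] [SMulCommClass S Rᵐᵒᵖ M]
    [Module S'ᵐᵒᵖ N] [SMulCommClass R S'ᵐᵒᵖ N] :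
    SMulCommClass S S'ᵐᵒᵖ (BTensor R M N) where
  smul_comm s t x := by
    induction x using induction_on with
    | tm m n => rfl
    | add x y hx hy => rw [smul_add, smul_add, hx, hy, smul_add, smul_add]

section Assoc

variable [Module Sᵐᵒᵖ N] [SMulCommClass R Sᵐᵒᵖ N] [Module S P]

/-- The map `m ⊗ n ↦ (p ↦ m ⊗ (n ⊗ p))`. -/
def assocHomAux : BTensor R M N →+ P →+ BTensor R M (BTensor S N P) :=
  lift
    { toFun := fun m =>
        { toFun := fun n =>
            { toFun := fun p => tmul R m (tmul S n p)
              map_zero' := by rw [tmul_zero, tmul_zero]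
              map_add' := fun p p' => by rw [tmul_add, tmul_add] }
          map_zero' := by ext p; simp [zero_tmul, tmul_zero]
          map_add' := fun n n' => by ext p; simp [add_tmul, tmul_add] }
      map_zero' := by ext n p; simp [zero_tmul]
      map_add' := fun m m' => by ext n p; simp [add_tmul] }
    (fun m r n => by ext p; simp [smul_tmul, smul_tmul_left])

/-- `(m ⊗ n) ⊗ p ↦ m ⊗ (n ⊗ p)`. -/
def assocHom : BTensor S (BTensor R M N) P →+ BTensor R M (BTensor S N P) :=
  lift assocHomAux
    (fun x s p => by
      induction x using induction_on with
      | tm m n =>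
        change tmul R m (tmul S (op s • n) p) = tmul R m (tmul S n (s • p))
        rw [smul_tmul]
      | add x y hx hy =>
        rw [smul_add, AddMonoidHom.map_add assocHomAux, AddMonoidHom.map_add assocHomAux,
          AddMonoidHom.add_apply, AddMonoidHom.add_apply, hx, hy])

/-- The map `m ↦ (n ⊗ p ↦ (m ⊗ n) ⊗ p)`. -/
def assocInvAux (m : M) : BTensor S N P →+ BTensor S (BTensor R M N) P :=
  lift
    { toFun := fun n =>
        { toFun := fun p => tmul S (tmul R m n) p
          map_zero' := by rw [tmul_zero]
          map_add' := fun p p' => by rw [tmul_add] }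
      map_zero' := by ext p; simp [zero_tmul, tmul_zero]
      map_add' := fun n n' => by ext p; simp [add_tmul, tmul_add] }
    (fun n s p => by simp [← smul_tmul, smul_tmul_right])

/-- `m ⊗ (n ⊗ p) ↦ (m ⊗ n) ⊗ p`. -/
def assocInv : BTensor R M (BTensor S N P) →+ BTensor S (BTensor R M N) P :=
  lift
    { toFun := assocInvAux
      map_zero' := hom_ext fun n p => by
        change tmul S (tmul R (0 : M) n) p = 0
        rw [zero_tmul, zero_tmul]
      map_add' := fun m m' => hom_ext fun n p => by
        change tmul S (tmul R (m + m') n) p = tmul S (tmul R m n) p + tmul S (tmul R m' n) p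
        rw [add_tmul, add_tmul] }
    (fun m r x => by
      change assocInvAux (op r • m) x = assocInvAux m (r • x)
      induction x using induction_on with
      | tm n p =>
        change tmul S (tmul R (op r • m) n) p = tmul S (tmul R m (r • n)) p
        rw [smul_tmul]
      | add x y hx hy =>
        rw [smul_add, AddMonoidHom.map_add, AddMonoidHom.map_add, hx, hy])

variable (R S M N P) in
/-- The associativity isomorphism `(M ⊗_R N) ⊗_S P ≃ M ⊗_R (N ⊗_S P)`. -/
def assoc : BTensor S (BTensor R M N) P ≃+ BTensor R M (BTensor S N P) :=
  AddMonoidHom.toAddEquiv assocHom assocInv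
    (hom_ext fun x p => by
      induction x using induction_on with
      | tm m n => rfl
      | add x y hx hy => rw [add_tmul, map_add, map_add, hx, hy])
    (hom_ext fun m x => by
      induction x using induction_on with
      | tm n p => rfl
      | add x y hx hy => rw [tmul_add, map_add, map_add, hx, hy])

@[simp] theorem assoc_tmul (m : M) (n : N) (p : P) :
    assoc R S M N P (tmul S (tmul R m n) p) = tmul R m (tmul S n p) := rfl

@[simp] theorem assoc_symm_tmul (m : M) (n : N) (p : P) :
    (assoc R S M N P).symm (tmul R m (tmul S n p)) = tmul S (tmul R m n) p := rfl

end Assoc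

variable (R N) in
/-- The canonical map `R ⊗_R N → N`, `r ⊗ n ↦ r n`. -/
def lid : BTensor R R N →+ N :=
  lift
    { toFun := fun r =>
        { toFun := fun n => r • n
          map_zero' := smul_zero r
          map_add' := smul_add r }
      map_zero' := by ext n; simp
      map_add' := fun r r' => by ext n; simp [add_smul] }
    (fun r s n => by simp [mul_smul])

variable (R M) in
/-- The canonical map `M ⊗_R R → M`, `m ⊗ r ↦ m r`. -/
def rid : BTensor R M R →+ M :=
  lift
    { toFun := fun m =>
        { toFun := fun r => op r • m
          map_zero' := by simp
          map_add' := fun r r' => by simp [add_smul] }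
      map_zero' := by ext r; simp
      map_add' := fun m m' => by ext r; simp }
    (fun m s r => by simp [mul_smul])

end BTensor

end Tensor

/-- Maps of `R`-`S`-bimodules. -/
structure BimodHom (R S M N : Type*) [Ring R] [Ring S] [AddCommGroup M] [AddCommGroup N]
    [Module R M] [Module Sᵐᵒᵖ M] [Module R N] [Module Sᵐᵒᵖ N] extends M →ₗ[R] N where
  map_op_smul' : ∀ (s : S) (m : M), toFun (op s • m) = op s • toFun m

namespace BimodHom

variable {R S M N : Type*} [Ring R] [Ring S] [AddCommGroup M] [AddCommGroup N]
    [Module R M] [Module Sᵐᵒᵖ M] [Module R N] [Module Sᵐᵒᵖ N]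

instance : CoeFun (BimodHom R S M N) (fun _ => M → N) := ⟨fun f => f.toLinearMap⟩

/-- The underlying map of left modules. -/
abbrev left (f : BimodHom R S M N) : M →ₗ[R] N := f.toLinearMap

/-- The underlying map of right modules. -/
def right (f : BimodHom R S M N) : M →ₗ[Sᵐᵒᵖ] N where
  toFun := f
  map_add' := map_add f.toLinearMap
  map_smul' s m := f.map_op_smul' s.unop m

end BimodHom

/-! ### Flatness, restriction to subalgebras, direct summands -/

/-- A right `T`-module `M` is flat if `M ⊗_T -` preserves injectivity of maps of left
`T`-modules. -/
def FlatRight (T : Type u) (M : Type v) [Ring T] [AddCommGroup M] [Module Tᵐᵒᵖ M] : Prop :=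
  ∀ (N N' : Type w) [AddCommGroup N] [AddCommGroup N'] [Module T N] [Module T N']
    (f : N →ₗ[T] N'), Injective f →
      Injective (BTensor.map (LinearMap.id : M →ₗ[Tᵐᵒᵖ] M) f)

/-- A left `T`-module `M` is flat if `- ⊗_T M` preserves injectivity of maps of right
`T`-modules. -/
def FlatLeft (T : Type u) (M : Type v) [Ring T] [AddCommGroup M] [Module T M] : Prop :=
  ∀ (N N' : Type w) [AddCommGroup N] [AddCommGroup N'] [Module Tᵐᵒᵖ N] [Module Tᵐᵒᵖ N']
    (f : N →ₗ[Tᵐᵒᵖ] N'), Injective f →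
      Injective (BTensor.map f (LinearMap.id : M →ₗ[T] M))

section Subalgebra

variable {k A : Type*} [CommRing k] [Ring A] [Algebra k A]

/-- The right action of a subalgebra `T` on `A` by right multiplication. -/
instance subalgebraRightModule (T : Subalgebra k A) : Module (↥T)ᵐᵒᵖ A :=
  Module.compHom A T.val.toRingHom.op

theorem op_smul_subalgebra (T : Subalgebra k A) (t : T) (a : A) : op t • a = a * (t : A) := rfl

instance subalgebraBimodule (S T : Subalgebra k A) : SMulCommClass S (↥T)ᵐᵒᵖ A where
  smul_comm s t a := (mul_assoc (s : A) a (t.unop : A)).symm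

instance subalgebraBimodule' (T : Subalgebra k A) : SMulCommClass A (↥T)ᵐᵒᵖ A where
  smul_comm s t a := (mul_assoc s a (t.unop : A)).symm

/-- A subalgebra `B` of `A` containing `T`, as a left `T`-submodule of `A`. -/
def asLeft (T B : Subalgebra k A) (h : T ≤ B) : Submodule T A where
  carrier := B
  add_mem' := B.add_mem
  zero_mem' := B.zero_mem
  smul_mem' t _ hb := B.mul_mem (h t.2) hb

/-- A subalgebra `B` of `A` containing `T`, as a right `T`-submodule of `A`. -/
def asRight (T B : Subalgebra k A) (h : T ≤ B) : Submodule (↥T)ᵐᵒᵖ A where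
  carrier := B
  add_mem' := B.add_mem
  zero_mem' := B.zero_mem
  smul_mem' t _ hb := B.mul_mem hb (h t.unop.2)

end Subalgebra

/-- A submodule is a direct summand if it has a complementary submodule. -/
def IsDirectSummand {S M : Type*} [Ring S] [AddCommGroup M] [Module S M]
    (N : Submodule S M) : Prop :=
  ∃ N' : Submodule S M, IsCompl N N'

/-! ### Rings and corings over a non-commutative base, entwining structures -/

/-- `A` is an `R`-ring: it is an `R`-`R`-bimodule and a ring such that the multiplication is
`R`-balanced and `R`-`R`-bilinear, and such that the unit map `r ↦ r 1 = 1 r` is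
`R`-`R`-bilinear. -/
class IsRRing (R A : Type*) [Ring R] [Ring A] [Module R A] [Module Rᵐᵒᵖ A] : Prop extends
    SMulCommClass R Rᵐᵒᵖ A, IsScalarTower R A A where
  mul_op_smul : ∀ (a : A) (r : R) (b : A), a * (op r • b) = op r • (a * b)
  balanced : ∀ (a : A) (r : R) (b : A), (op r • a) * b = a * (r • b)
  smul_one_eq : ∀ r : R, r • (1 : A) = op r • (1 : A)

instance rRingMulBimodule {R A : Type*} [Ring R] [Ring A] [Module R A] [Module Rᵐᵒᵖ A]
    [IsRRing R A] : SMulCommClass A Rᵐᵒᵖ A where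
  smul_comm a r b := IsRRing.mul_op_smul a r.unop b

instance rRingSubalgebraBimodule {k R A : Type*} [CommRing k] [Ring R] [Ring A] [Algebra k A]
    [Module R A] [Module Rᵐᵒᵖ A] [IsRRing R A] (T : Subalgebra k A) :
    SMulCommClass R (↥T)ᵐᵒᵖ A where
  smul_comm r t a := (smul_mul_assoc r a (t.unop : A)).symm

/-- The multiplication of an `R`-ring `A`, as an `R`-`R`-bimodule map `A ⊗_R A → A`. -/
def mulHom (R A : Type*) [Ring R] [Ring A] [Module R A] [Module Rᵐᵒᵖ A] [IsRRing R A] :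
    BimodHom R R (BTensor R A A) A where
  toFun := BTensor.lift (AddMonoidHom.mul : A →+ A →+ A) IsRRing.balanced
  map_add' := map_add _
  map_smul' r x := by
    induction x using BTensor.induction_on with
    | tm a b => exact smul_mul_assoc r a b
    | add x y hx hy => rw [smul_add, map_add, map_add, hx, hy, smul_add]
  map_op_smul' r x := by
    induction x using BTensor.induction_on with
    | tm a b => exact IsRRing.mul_op_smul a r b
    | add x y hx hy =>
      change BTensor.lift _ _ (op r • x) = op r • BTensor.lift _ _ x at hx
      change BTensor.lift _ _ (op r • y) = op r • BTensor.lift _ _ y at hy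
      rw [smul_add, map_add, map_add, hx, hy, smul_add]

/-- The structure of an `R`-coring on an `R`-`R`-bimodule `C`: a coassociative, counital
comultiplication `C → C ⊗_R C` and counit `C → R`, both `R`-`R`-bilinear. -/
structure Coring (R C : Type*) [Ring R] [AddCommGroup C] [Module R C] [Module Rᵐᵒᵖ C]
    [SMulCommClass R Rᵐᵒᵖ C] where
  comul : BimodHom R R C (BTensor R C C)
  counit : BimodHom R R C R
  coassoc : ∀ c : C,
    BTensor.assoc R R C C C (BTensor.map comul.right LinearMap.id (comul c)) =
      BTensor.map LinearMap.id comul.left (comul c)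
  counit_left : ∀ c : C,
    BTensor.lid R C (BTensor.map counit.right LinearMap.id (comul c)) = c
  counit_right : ∀ c : C,
    BTensor.rid R C (BTensor.map LinearMap.id counit.left (comul c)) = c

namespace Coring

variable {R C : Type*} [Ring R] [AddCommGroup C] [Module R C] [Module Rᵐᵒᵖ C]
    [SMulCommClass R Rᵐᵒᵖ C]

/-- Grouplike elements of a coring. -/
structure IsGrouplike (K : Coring R C) (e : C) : Prop where
  comul_eq : K.comul e = BTensor.tmul R e e
  counit_eq : K.counit e = 1

end Coring

/-- A right entwining structure `(A, C, ψ)_R`: an `R`-`R`-bilinear map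
`ψ : C ⊗_R A → A ⊗_R C` compatible with multiplication, unit, comultiplication and counit.
The compatibility conditions are stated on elementary tensors. -/
structure Entwining (R A : Type*) {C : Type*} [Ring R] [Ring A] [Module R A] [Module Rᵐᵒᵖ A]
    [IsRRing R A] [AddCommGroup C] [Module R C] [Module Rᵐᵒᵖ C] [SMulCommClass R Rᵐᵒᵖ C]
    (K : Coring R C) where
  psi : BimodHom R R (BTensor R C A) (BTensor R A C)
  psi_mul : ∀ (c : C) (a a' : A),
    psi (BTensor.tmul R c (a * a')) =
      BTensor.map (mulHom R A).right LinearMap.id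
        ((BTensor.assoc R R A A C).symm
          (BTensor.map LinearMap.id psi.left
            (BTensor.assoc R R A C A (BTensor.tmul R (psi (BTensor.tmul R c a)) a'))))
  psi_one : ∀ c : C, psi (BTensor.tmul R c 1) = BTensor.tmul R 1 c
  psi_comul : ∀ (c : C) (a : A),
    BTensor.map LinearMap.id K.comul.left (psi (BTensor.tmul R c a)) =
      BTensor.assoc R R A C C
        (BTensor.map psi.right LinearMap.id
          ((BTensor.assoc R R C A C).symm
            (BTensor.map LinearMap.id psi.left
              (BTensor.assoc R R C C A (BTensor.tmul R (K.comul c) a)))))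
  psi_counit : ∀ (c : C) (a : A),
    BTensor.rid R A (BTensor.map LinearMap.id K.counit.left (psi (BTensor.tmul R c a))) =
      K.counit c • a

namespace Entwining

theorem mul_map_assoc_tmul {R A C : Type*} [Ring R] [Ring A] [Module R A] [Module Rᵐᵒᵖ A]
    [IsRRing R A] [AddCommGroup C] [Module R C] (a : A) (y : BTensor R A C) :
    BTensor.map (mulHom R A).right LinearMap.id
      ((BTensor.assoc R R A A C).symm (BTensor.tmul R a y)) = a • y := by
  induction y using BTensor.induction_on with
  | tm a' c => rfl
  | add x y hx hy => rw [BTensor.tmul_add, map_add, map_add, hx, hy, smul_add]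

section Coaction

variable {R A C : Type*} [Ring R] [Ring A] [Module R A] [Module Rᵐᵒᵖ A]
    [IsRRing R A] [AddCommGroup C] [Module R C] [Module Rᵐᵒᵖ C] [SMulCommClass R Rᵐᵒᵖ C]
    {K : Coring R C} (E : Entwining R A K)

/-- The right coaction `a ↦ ψ(e ⊗ a)` on `A`. -/
def rightCoaction (e : C) : A →+ BTensor R A C where
  toFun a := E.psi (BTensor.tmul R e a)
  map_zero' := by rw [BTensor.tmul_zero, map_zero]
  map_add' a b := by rw [BTensor.tmul_add, map_add]

/-- The left coaction `a ↦ ψ⁻¹(a ⊗ e)` on `A`, for bijective `ψ`. -/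
def leftCoaction (hE : Bijective E.psi) (e : C) : A →+ BTensor R C A where
  toFun a := (AddEquiv.ofBijective E.psi.toLinearMap hE).symm (BTensor.tmul R a e)
  map_zero' := by rw [BTensor.zero_tmul, map_zero]
  map_add' a b := by rw [BTensor.add_tmul, map_add]

theorem psi_leftCoaction (hE : Bijective E.psi) (e : C) (a : A) :
    E.psi (E.leftCoaction hE e a) = BTensor.tmul R a e :=
  (AddEquiv.ofBijective E.psi.toLinearMap hE).apply_symm_apply (BTensor.tmul R a e)

theorem rightCoaction_mul (e : C) {b : A} (hb : E.rightCoaction e b = BTensor.tmul R b e)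
    (a : A) : E.rightCoaction e (b * a) = b • E.rightCoaction e a := by
  change E.psi (BTensor.tmul R e b) = BTensor.tmul R b e at hb
  change E.psi _ = _
  rw [E.psi_mul, hb, BTensor.assoc_tmul, BTensor.map_tmul, mul_map_assoc_tmul]
  rfl

theorem psi_op_smul {k : Type*} [CommRing k] [Algebra k A] (T : Subalgebra k A) (t : T) (y : BTensor R C A) :
    E.psi (op t • y) =
      BTensor.map (mulHom R A).right LinearMap.id
        ((BTensor.assoc R R A A C).symm
          (BTensor.map LinearMap.id E.psi.left
            (BTensor.assoc R R A C A (BTensor.tmul R (E.psi y) (t : A))))) := by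
  induction y using BTensor.induction_on with
  | tm c a => exact E.psi_mul c a t
  | add x y hx hy =>
    rw [smul_add, map_add, hx, hy, map_add, BTensor.add_tmul, map_add, map_add, map_add, map_add]

end Coaction

section Coinvariants

variable {k R A C : Type*} [CommRing k] [Ring R] [Algebra k R] [Ring A] [Algebra k A]
    [Module R A] [Module Rᵐᵒᵖ A] [IsRRing R A] [IsScalarTower k R A]
    [AddCommGroup C] [Module R C] [Module Rᵐᵒᵖ C] [SMulCommClass R Rᵐᵒᵖ C]
    [Module k C] [IsScalarTower k R C] [IsScalarTower k Rᵐᵒᵖ C]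
    {K : Coring R C} (E : Entwining R A K)

variable (k) in
/-- The `k`-subalgebra `{b ∈ A | ϱ(b) = b ⊗ e}` of coinvariants of `A` with respect to the
coaction `ϱ(a) = ψ(e ⊗ a)`. -/
def coinvariants (e : C) : Subalgebra k A where
  carrier := {b | E.rightCoaction e b = BTensor.tmul R b e}
  add_mem' {a b} ha hb := by
    change _ = _ at ha hb
    change _ = _
    rw [map_add, ha, hb, BTensor.add_tmul]
  mul_mem' {a b} ha hb := by
    change _ = _ at ha hb
    change _ = _
    rw [E.rightCoaction_mul e ha, hb]
    rfl
  algebraMap_mem' x := by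
    have h1 : algebraMap k A x = (algebraMap k R x) • (1 : A) := by
      rw [algebraMap_smul, Algebra.algebraMap_eq_smul_one]
    have h2 : op (algebraMap k R x) • e = (algebraMap k R x) • e := by
      rw [algebraMap_smul]
      exact algebraMap_smul Rᵐᵒᵖ x e
    change E.psi (BTensor.tmul R e (algebraMap k A x)) = BTensor.tmul R (algebraMap k A x) e
    rw [h1, ← BTensor.smul_tmul, E.psi_one, h2, IsRRing.smul_one_eq, BTensor.smul_tmul]

theorem mem_coinvariants (e : C) (b : A) :
    b ∈ E.coinvariants k e ↔ E.rightCoaction e b = BTensor.tmul R b e := Iff.rfl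

variable {E} in
/-- The right coaction as a left `T`-linear map, for a subalgebra `T` of coinvariants. -/
def rightCoactionLin {e : C} {T : Subalgebra k A} (hT : T ≤ E.coinvariants k e) :
    A →ₗ[T] BTensor R A C where
  toFun := E.rightCoaction e
  map_add' := map_add _
  map_smul' t a := E.rightCoaction_mul e (hT t.2) a

variable {E} in
/-- The left coaction as a right `T`-linear map, for a subalgebra `T` of coinvariants. -/
def leftCoactionLin (hE : Bijective E.psi) {e : C} {T : Subalgebra k A}
    (hT : T ≤ E.coinvariants k e) : A →ₗ[(↥T)ᵐᵒᵖ] BTensor R C A where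
  toFun := E.leftCoaction hE e
  map_add' := map_add _
  map_smul' t a := by
    apply hE.1
    have ht : E.psi (BTensor.tmul R e (t.unop : A)) = BTensor.tmul R (t.unop : A) e :=
      hT t.unop.2
    have h := E.psi_op_smul T t.unop (E.leftCoaction hE e a)
    rw [op_unop, E.psi_leftCoaction, BTensor.assoc_tmul, BTensor.map_tmul,
      mul_map_assoc_tmul] at h
    rw [RingHom.id_apply, h, E.psi_leftCoaction]
    exact (congrArg (fun z => a • z) ht).symm

variable {E} in
/-- The lifted canonical map `A ⊗_T A → A ⊗_R C`, `a ⊗ a' ↦ a ϱ(a')`. -/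
def canLift {e : C} {T : Subalgebra k A} (hT : T ≤ E.coinvariants k e) :
    BTensor T A A →+ BTensor R A C :=
  BTensor.lift
    { toFun := fun a =>
        { toFun := fun a' => a • E.rightCoaction e a'
          map_zero' := by rw [map_zero, smul_zero]
          map_add' := fun a' a'' => by rw [map_add, smul_add] }
      map_zero' := by ext a'; simp
      map_add' := fun a b => by ext a'; simp [add_smul] }
    (fun a t a' => by
      change (a * (t : A)) • E.rightCoaction e a' = a • E.rightCoaction e ((t : A) * a')
      rw [E.rightCoaction_mul e (hT t.2), mul_smul])

/-- A strong `T`-connection, for a subalgebra `T` of coinvariants: a left and right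
`C`-comodule map `ℓ : C → A ⊗_T A`, where `A ⊗_T A` is a right comodule through the right
coaction on the second factor and a left comodule through the left coaction on the first
factor, such that the lifted canonical map sends `ℓ c` to `1 ⊗ c`. -/
structure IsStrongConnection (hE : Bijective E.psi) {e : C} {T : Subalgebra k A}
    (hT : T ≤ E.coinvariants k e) (l : BimodHom R R C (BTensor T A A)) : Prop where
  right_colinear : ∀ c : C,
    BTensor.assoc T R A A C (BTensor.map l.right LinearMap.id (K.comul c)) =
      BTensor.map LinearMap.id (rightCoactionLin hT) (l c)
  left_colinear : ∀ c : C,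
    BTensor.map LinearMap.id l.left (K.comul c) =
      BTensor.assoc R T C A A (BTensor.map (leftCoactionLin hE hT) LinearMap.id (l c))
  canLift_eq : ∀ c : C, canLift hT (l c) = BTensor.tmul R 1 c

end Coinvariants

end Entwining

end EntwinedExt

end

open EntwinedExt

set_option linter.unusedSectionVars false

/-! Everything rests on the element `ℓ(e)`. As `Δ(e) = e ⊗ e`, colinearity of `ℓ` gives `(A ⊗
ϱ)(ℓ(e)) = ℓ(e) ⊗ e` and `(λ ⊗ A)(ℓ(e)) = e ⊗ ℓ(e)`. Both `ϱ - (- ⊗ e)` and `λ - (e ⊗ -)` have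
kernel `B`, so flatness should place `ℓ(e)` in the image of `B ⊗_T B`.

The obstacle is that no flatness is known for `A ⊗_R C` or `C ⊗_R A`. The connection removes it: `a
⊗ c ↦ a ℓ(c)` and `c ⊗ a ↦ ℓ(c) a` embed these modules `T`-linearly into `A ⊗_T A`, because the
lifted canonical map turns them into the identity and into `ψ`. Tensoring with `A ⊗_T A` is exact on
the side where tensoring with `A` is. This gives `exists_tensor_of_flatLeft` and
`exists_tensor_of_flatRight`.

For (1), take a left `T`-linear projection `p` of `A` onto `B`, and let `φ(c)` be the image of
`ℓ(c)` under `x ⊗ y ↦ x p(y)`. Then `φ` is left colinear, and `φ(e) = 1` because `p` fixes the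
second legs of `ℓ(e)`. In Sweedler notation for `ϱ`, the map `a ↦ a₀ φ(a₁)` is left `B`-linear, has
values in `B` (`rightCoaction_mulRightMap`), and sends `b` to `b φ(e) = b`. Part (2) is symmetric,
with `φ` built from `p(x) y` and the map `a ↦ φ(a₋₁) a₀` formed with `λ`
(`rightCoaction_mulLeftMap`). -/

namespace EntwinedExt

/-! ### Functoriality and right exactness of the tensor product over a noncommutative ring. -/

section Exactness

variable {T : Type*} [Ring T]

namespace BTensor

variable {M N P Q : Type*} [AddCommGroup M] [AddCommGroup N] [AddCommGroup P] [AddCommGroup Q]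

theorem map_map {M' N' M'' N'' : Type*} [AddCommGroup M'] [AddCommGroup N'] [AddCommGroup M'']
    [AddCommGroup N''] [Module Tᵐᵒᵖ M] [Module T N] [Module Tᵐᵒᵖ M'] [Module T N']
    [Module Tᵐᵒᵖ M''] [Module T N''] (f' : M' →ₗ[Tᵐᵒᵖ] M'') (g' : N' →ₗ[T] N'')
    (f : M →ₗ[Tᵐᵒᵖ] M') (g : N →ₗ[T] N') (z : BTensor T M N) :
    map f' g' (map f g z) = map (f' ∘ₗ f) (g' ∘ₗ g) z := by
  induction z using induction_on with
  | tm m n => rfl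
  | add x y hx hy => simp only [map_add, hx, hy]

/-- The tensor product of two linear equivalences. -/
def congr {M' N' : Type*} [AddCommGroup M'] [AddCommGroup N']
    [Module Tᵐᵒᵖ M] [Module T N] [Module Tᵐᵒᵖ M'] [Module T N']
    (f : M ≃ₗ[Tᵐᵒᵖ] M') (g : N ≃ₗ[T] N') : BTensor T M N ≃+ BTensor T M' N' :=
  AddMonoidHom.toAddEquiv (map f.toLinearMap g.toLinearMap)
    (map f.symm.toLinearMap g.symm.toLinearMap)
    (hom_ext fun m n => by simp) (hom_ext fun m n => by simp)

/-- Right exactness of `- ⊗_T N`. -/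
theorem mem_range_of_map_mkQ_left [Module Tᵐᵒᵖ M] [Module T N] (K : Submodule Tᵐᵒᵖ M)
    {z : BTensor T M N} (hz : map K.mkQ (LinearMap.id : N →ₗ[T] N) z = 0) :
    ∃ y : BTensor T K N, map K.subtype LinearMap.id y = z := by
  let I : AddSubgroup (BTensor T M N) :=
    (map K.subtype (LinearMap.id : N →ₗ[T] N)).range
  let a : M →+ N →+ BTensor T M N ⧸ I :=
    { toFun := fun m =>
        { toFun := fun n => QuotientAddGroup.mk' I (tmul T m n)
          map_zero' := by rw [tmul_zero, map_zero]
          map_add' := fun n n' => by rw [tmul_add, map_add] }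
      map_zero' := by ext n; simp [zero_tmul]
      map_add' := fun m m' => by ext n; simp [add_tmul] }
  let b : (M ⧸ K) →+ N →+ BTensor T M N ⧸ I :=
    -- The projection of `M ⊗ N` onto its quotient by the image of `K ⊗ N` factors through `(M ⧸ K)
    -- ⊗ N`, so whatever dies there lies in that image.
    QuotientAddGroup.lift K.toAddSubgroup a (by
      intro m hm
      ext n
      exact (QuotientAddGroup.eq_zero_iff _).2 ⟨tmul T (⟨m, hm⟩ : K) n, rfl⟩)
  let c : BTensor T (M ⧸ K) N →+ BTensor T M N ⧸ I := lift b (by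
    intro m t n
    obtain ⟨m, rfl⟩ := K.mkQ_surjective m
    exact congrArg (QuotientAddGroup.mk' I) (smul_tmul m t n))
  have h : c.comp (map K.mkQ (LinearMap.id : N →ₗ[T] N)) = QuotientAddGroup.mk' I :=
    hom_ext fun m n => rfl
  have h0 : QuotientAddGroup.mk' I z = 0 := by
    rw [← h, AddMonoidHom.comp_apply, hz, map_zero]
  exact (QuotientAddGroup.eq_zero_iff z).1 h0

/-- Right exactness of `M ⊗_T -`. -/
theorem mem_range_of_map_mkQ_right [Module Tᵐᵒᵖ M] [Module T N] (K : Submodule T N)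
    {z : BTensor T M N} (hz : map (LinearMap.id : M →ₗ[Tᵐᵒᵖ] M) K.mkQ z = 0) :
    ∃ y : BTensor T M K, map LinearMap.id K.subtype y = z := by
  let I : AddSubgroup (BTensor T M N) :=
    (map (LinearMap.id : M →ₗ[Tᵐᵒᵖ] M) K.subtype).range
  let a : N →+ M →+ BTensor T M N ⧸ I :=
    { toFun := fun n =>
        { toFun := fun m => QuotientAddGroup.mk' I (tmul T m n)
          map_zero' := by rw [zero_tmul, map_zero]
          map_add' := fun n n' => by rw [add_tmul, map_add] }
      map_zero' := by ext n; simp [tmul_zero]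
      map_add' := fun m m' => by ext n; simp [tmul_add] }
  let b : (N ⧸ K) →+ M →+ BTensor T M N ⧸ I :=
    QuotientAddGroup.lift K.toAddSubgroup a (by
      intro n hn
      ext m
      exact (QuotientAddGroup.eq_zero_iff _).2 ⟨tmul T m (⟨n, hn⟩ : K), rfl⟩)
  let c : BTensor T M (N ⧸ K) →+ BTensor T M N ⧸ I := lift b.flip (by
    intro m t n
    obtain ⟨n, rfl⟩ := K.mkQ_surjective n
    exact congrArg (QuotientAddGroup.mk' I) (smul_tmul m t n))
  have h : c.comp (map (LinearMap.id : M →ₗ[Tᵐᵒᵖ] M) K.mkQ) = QuotientAddGroup.mk' I :=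
    hom_ext fun m n => rfl
  have h0 : QuotientAddGroup.mk' I z = 0 := by
    rw [← h, AddMonoidHom.comp_apply, hz, map_zero]
  exact (QuotientAddGroup.eq_zero_iff z).1 h0

end BTensor

end Exactness

/-! ### Flatness and the descent of a tensor to a pair of kernels. -/

section Flat

variable {T : Type u} [Ring T]

/-- Conjugating by `ULift` moves a test map to the larger universe. Only the universe of `A` is
needed later, since all test maps there are between modules built from `A` and `T`. -/
theorem FlatLeft.of_max {M : Type v} [AddCommGroup M] [Module T M]
    (h : FlatLeft.{u, v, max w x} T M) : FlatLeft.{u, v, w} T M := by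
  intro N N' _ _ _ _ f hf
  let g : ULift.{x} N →ₗ[Tᵐᵒᵖ] ULift.{x} N' :=
    ULift.moduleEquiv.symm.toLinearMap ∘ₗ f ∘ₗ ULift.moduleEquiv.toLinearMap
  have hg : Injective g :=
    ULift.moduleEquiv.symm.injective.comp (hf.comp ULift.moduleEquiv.injective)
  have := h _ _ g hg
  intro y z hyz
  apply (BTensor.congr (ULift.moduleEquiv.{u, w, x} (R := Tᵐᵒᵖ) (M := N)).symm
    (LinearEquiv.refl T M)).injective
  apply this
  have hc : ∀ y : BTensor T N M, BTensor.map g LinearMap.id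
      ((BTensor.congr (ULift.moduleEquiv.{u, w, x} (R := Tᵐᵒᵖ) (M := N)).symm
        (LinearEquiv.refl T M)) y) =
      BTensor.map (ULift.moduleEquiv.{u, w, x} (R := Tᵐᵒᵖ) (M := N')).symm.toLinearMap
        LinearMap.id (BTensor.map f LinearMap.id y) := fun y => by
    rw [BTensor.map_map]
    exact BTensor.map_map _ _ _ _ y
  rw [hc, hc, hyz]

theorem FlatRight.of_max {M : Type v} [AddCommGroup M] [Module Tᵐᵒᵖ M]
    (h : FlatRight.{u, v, max w x} T M) : FlatRight.{u, v, w} T M := by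
  intro N N' _ _ _ _ f hf
  let g : ULift.{x} N →ₗ[T] ULift.{x} N' :=
    ULift.moduleEquiv.symm.toLinearMap ∘ₗ f ∘ₗ ULift.moduleEquiv.toLinearMap
  have hg : Injective g :=
    ULift.moduleEquiv.symm.injective.comp (hf.comp ULift.moduleEquiv.injective)
  have := h _ _ g hg
  intro y z hyz
  apply (BTensor.congr (LinearEquiv.refl Tᵐᵒᵖ M)
    (ULift.moduleEquiv.{u, w, x} (R := T) (M := N)).symm).injective
  apply this
  have hc : ∀ y : BTensor T M N, BTensor.map LinearMap.id g
      ((BTensor.congr (LinearEquiv.refl Tᵐᵒᵖ M)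
        (ULift.moduleEquiv.{u, w, x} (R := T) (M := N)).symm) y) =
      BTensor.map LinearMap.id (ULift.moduleEquiv.{u, w, x} (R := T) (M := N')).symm.toLinearMap
        (BTensor.map LinearMap.id f y) := fun y => by
    rw [BTensor.map_map]
    exact BTensor.map_map _ _ _ _ y
  rw [hc, hc, hyz]

/-- The map `g` induces an injection on `N ⧸ ker g`, which flatness preserves; hence `z` already
vanishes in `(N ⧸ K) ⊗ M`, and right exactness applies. Keeping `K` separate from `ker g` lets the
result speak directly of the coinvariants. -/
theorem FlatLeft.exists_of_map_eq_zero {M : Type v} [AddCommGroup M] [Module T M]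
    (h : FlatLeft.{u, v, w} T M) {N N' : Type w} [AddCommGroup N] [AddCommGroup N']
    [Module Tᵐᵒᵖ N] [Module Tᵐᵒᵖ N'] {g : N →ₗ[Tᵐᵒᵖ] N'} {K : Submodule Tᵐᵒᵖ N}
    (hK : LinearMap.ker g = K) {z : BTensor T N M} (hz : BTensor.map g LinearMap.id z = 0) :
    ∃ y : BTensor T K M, BTensor.map K.subtype LinearMap.id y = z := by
  subst hK
  apply BTensor.mem_range_of_map_mkQ_left
  apply h _ _ ((LinearMap.ker g).liftQ g le_rfl)
    (LinearMap.ker_eq_bot.1 (Submodule.ker_liftQ_eq_bot _ _ _ le_rfl))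
  rw [BTensor.map_map, map_zero, Submodule.liftQ_mkQ]
  exact hz

theorem FlatRight.exists_of_map_eq_zero {M : Type v} [AddCommGroup M] [Module Tᵐᵒᵖ M]
    (h : FlatRight.{u, v, w} T M) {N N' : Type w} [AddCommGroup N] [AddCommGroup N']
    [Module T N] [Module T N'] {g : N →ₗ[T] N'} {K : Submodule T N}
    (hK : LinearMap.ker g = K) {z : BTensor T M N} (hz : BTensor.map LinearMap.id g z = 0) :
    ∃ y : BTensor T M K, BTensor.map LinearMap.id K.subtype y = z := by
  subst hK
  apply BTensor.mem_range_of_map_mkQ_right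
  apply h _ _ ((LinearMap.ker g).liftQ g le_rfl)
    (LinearMap.ker_eq_bot.1 (Submodule.ker_liftQ_eq_bot _ _ _ le_rfl))
  rw [BTensor.map_map, map_zero, Submodule.liftQ_mkQ]
  exact hz

variable {A : Type w} [AddCommGroup A] [Module T A] [Module Tᵐᵒᵖ A] [SMulCommClass T Tᵐᵒᵖ A]

/-- By associativity, tensoring with `A ⊗_T A` is tensoring with `A` twice. -/
theorem FlatLeft.map_tensor_self_injective (h : FlatLeft.{u, w, w} T A) {N N' : Type w}
    [AddCommGroup N] [AddCommGroup N'] [Module Tᵐᵒᵖ N] [Module Tᵐᵒᵖ N'] (f : N →ₗ[Tᵐᵒᵖ] N')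
    (hf : Injective f) :
    Injective (BTensor.map f (LinearMap.id : BTensor T A A →ₗ[T] BTensor T A A)) := by
  let g : BTensor T N A →ₗ[Tᵐᵒᵖ] BTensor T N' A :=
    { toFun := BTensor.map f LinearMap.id
      map_add' := map_add _
      map_smul' := fun t z => by
        induction z using BTensor.induction_on with
        | tm m n => rfl
        | add x y hx hy => simp only [smul_add, map_add, hx, hy] }
  have h2 := h _ _ g (h _ _ f hf)
  have hc : BTensor.map f (LinearMap.id : BTensor T A A →ₗ[T] BTensor T A A) =
      ((BTensor.assoc T T N' A A).toAddMonoidHom.comp (BTensor.map g LinearMap.id)).comp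
        (BTensor.assoc T T N A A).symm.toAddMonoidHom :=
    BTensor.hom_ext fun n z => by
      induction z using BTensor.induction_on with
      | tm m n => rfl
      | add x y hx hy => rw [BTensor.tmul_add, map_add, map_add, hx, hy]
  rw [hc]
  exact ((BTensor.assoc T T N' A A).injective.comp h2).comp (BTensor.assoc T T N A A).symm.injective

theorem FlatRight.map_tensor_self_injective (h : FlatRight.{u, w, w} T A) {N N' : Type w}
    [AddCommGroup N] [AddCommGroup N'] [Module T N] [Module T N'] (f : N →ₗ[T] N')
    (hf : Injective f) :
    Injective (BTensor.map (LinearMap.id : BTensor T A A →ₗ[Tᵐᵒᵖ] BTensor T A A) f) := by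
  let g : BTensor T A N →ₗ[T] BTensor T A N' :=
    { toFun := BTensor.map LinearMap.id f
      map_add' := map_add _
      map_smul' := fun t z => by
        induction z using BTensor.induction_on with
        | tm m n => rfl
        | add x y hx hy => simp only [smul_add, map_add, hx, hy] }
  have h2 := h _ _ g (h _ _ f hf)
  have hc : BTensor.map (LinearMap.id : BTensor T A A →ₗ[Tᵐᵒᵖ] BTensor T A A) f =
      ((BTensor.assoc T T A A N').symm.toAddMonoidHom.comp (BTensor.map LinearMap.id g)).comp
        (BTensor.assoc T T A A N).toAddMonoidHom :=
    BTensor.hom_ext fun z n => by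
      induction z using BTensor.induction_on with
      | tm m n => rfl
      | add x y hx hy => rw [BTensor.add_tmul, map_add, map_add, hx, hy]
  rw [hc]
  exact ((BTensor.assoc T T A A N').symm.injective.comp h2).comp (BTensor.assoc T T A A N).injective

/-- One leg is treated at a time: flatness of `A` moves the first leg into `K`, then flatness of `K`
moves the second into `L`. That `D` takes values in `A ⊗_T A` is essential to the passage between
the two. -/
theorem exists_tensor_of_flatLeft (h : FlatLeft.{u, w, w} T A) {K : Submodule Tᵐᵒᵖ A}
    {L : Submodule T A} (hK : FlatRight.{u, w, w} T K)
    {D : A →ₗ[T] BTensor T A A} {D' : A →ₗ[Tᵐᵒᵖ] BTensor T A A}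
    (hD : LinearMap.ker D = L) (hD' : LinearMap.ker D' = K) {z : BTensor T A A}
    (hz : BTensor.map LinearMap.id D z = 0) (hz' : BTensor.map D' LinearMap.id z = 0) :
    ∃ y : BTensor T K L, BTensor.map K.subtype L.subtype y = z := by
  obtain ⟨y, rfl⟩ := h.exists_of_map_eq_zero hD' hz'
  -- The vanishing is known only in `A ⊗ (A ⊗ A)`; it descends because `K ⊗ (A ⊗ A)` embeds there.
  have hy : BTensor.map LinearMap.id D y = 0 := by
    apply h.map_tensor_self_injective K.subtype K.subtype_injective
    rw [BTensor.map_map, map_zero, ← hz, BTensor.map_map]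
    rfl
  obtain ⟨x, rfl⟩ := hK.exists_of_map_eq_zero hD hy
  exact ⟨x, by rw [BTensor.map_map]; rfl⟩

/-- The mirror argument, now starting with the second leg. -/
theorem exists_tensor_of_flatRight (h : FlatRight.{u, w, w} T A) {K : Submodule Tᵐᵒᵖ A}
    {L : Submodule T A} (hL : FlatLeft.{u, w, w} T L)
    {D : A →ₗ[T] BTensor T A A} {D' : A →ₗ[Tᵐᵒᵖ] BTensor T A A}
    (hD : LinearMap.ker D = L) (hD' : LinearMap.ker D' = K) {z : BTensor T A A}
    (hz : BTensor.map LinearMap.id D z = 0) (hz' : BTensor.map D' LinearMap.id z = 0) :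
    ∃ y : BTensor T K L, BTensor.map K.subtype L.subtype y = z := by
  obtain ⟨y, rfl⟩ := h.exists_of_map_eq_zero hD hz
  have hy : BTensor.map D' LinearMap.id y = 0 := by
    apply h.map_tensor_self_injective L.subtype L.subtype_injective
    rw [BTensor.map_map, map_zero, ← hz', BTensor.map_map]
    rfl
  obtain ⟨x, rfl⟩ := hL.exists_of_map_eq_zero hD' hy
  exact ⟨x, by rw [BTensor.map_map]; rfl⟩

end Flat

/-! ### Direct summands as images of projections. -/

section DirectSummand

variable {S M : Type*} [Ring S] [AddCommGroup M] [Module S M]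

theorem IsDirectSummand.exists_projection {N : Submodule S M} (h : IsDirectSummand N) :
    ∃ p : M →ₗ[S] M, (∀ m, p m ∈ N) ∧ ∀ m ∈ N, p m = m := by
  obtain ⟨N', h⟩ := h
  exact ⟨N.projection N' h, Submodule.projection_apply_mem h, fun m hm =>
    Submodule.projection_apply_left h ⟨m, hm⟩⟩

theorem IsDirectSummand.of_projection {N : Submodule S M} (p : M →ₗ[S] M)
    (h1 : ∀ m, p m ∈ N) (h2 : ∀ m ∈ N, p m = m) : IsDirectSummand N :=
  ⟨_, LinearMap.isCompl_of_proj (f := p.codRestrict N h1)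
    fun m => Subtype.ext (h2 m m.2)⟩

end DirectSummand

namespace BTensor

variable {R S M N M' N' : Type*} [Ring R] [Ring S] [AddCommGroup M] [AddCommGroup N]
  [AddCommGroup M'] [AddCommGroup N'] [Module Rᵐᵒᵖ M] [Module R N] [Module Rᵐᵒᵖ M']
  [Module R N']

variable (M) in
/-- The left `S`-linear map `M ⊗_R g`. -/
def lTensor (S : Type*) [Ring S] [Module S M] [SMulCommClass S Rᵐᵒᵖ M] (g : N →ₗ[R] N') :
    BTensor R M N →ₗ[S] BTensor R M N' where
  toFun := map LinearMap.id g
  map_add' := map_add _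
  map_smul' s z := by
    induction z using induction_on with
    | tm m n => rfl
    | add x y hx hy => simp only [smul_add, map_add, hx, hy]

theorem map_id_sub (f g : N →ₗ[R] N') (z : BTensor R M N) :
    map (LinearMap.id : M →ₗ[Rᵐᵒᵖ] M) (f - g) z =
      map LinearMap.id f z - map LinearMap.id g z := by
  induction z using induction_on with
  | tm m n =>
    rw [eq_sub_iff_add_eq, map_tmul, map_tmul, map_tmul, ← tmul_add, LinearMap.sub_apply,
      sub_add_cancel]
  | add x y hx hy => rw [map_add, map_add, map_add, hx, hy]; abel

theorem map_sub_id (f g : M →ₗ[Rᵐᵒᵖ] M') (z : BTensor R M N) :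
    map (f - g) (LinearMap.id : N →ₗ[R] N) z =
      map f LinearMap.id z - map g LinearMap.id z := by
  induction z using induction_on with
  | tm m n =>
    rw [eq_sub_iff_add_eq, map_tmul, map_tmul, map_tmul, ← add_tmul, LinearMap.sub_apply,
      sub_add_cancel]
  | add x y hx hy => rw [map_add, map_add, map_add, hx, hy]; abel

end BTensor

/-! ### Multiplication of `A` twisted by a `T`-linear map on one leg. -/

section Mul

variable {k A : Type*} [CommRing k] [Ring A] [Algebra k A] {T : Subalgebra k A}

/-- The map `A ⊗_T A → A`, `x ⊗ y ↦ x p(y)`. -/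
def mulApplyRight (S : Type*) [Ring S] [Module S A] [SMulCommClass S (↥T)ᵐᵒᵖ A]
    [IsScalarTower S A A] (p : A →ₗ[T] A) : BTensor T A A →ₗ[S] A where
  toFun := BTensor.lift ((AddMonoidHom.mul : A →+ A →+ A).compl₂ p.toAddMonoidHom)
    (fun x t y => by
      change x * (t : A) * p y = x * p (t • y)
      rw [p.map_smul, mul_assoc]; rfl)
  map_add' := map_add _
  map_smul' s z := by
    induction z using BTensor.induction_on with
    | tm a b => exact smul_mul_assoc s a (p b)
    | add x y hx hy => rw [smul_add, map_add, map_add, hx, hy, smul_add]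

/-- The map `A ⊗_T A → A`, `x ⊗ y ↦ p(x) y`. -/
def mulApplyLeft (S : Type*) [Ring S] [Module Sᵐᵒᵖ A] [SMulCommClass T Sᵐᵒᵖ A]
    [SMulCommClass A Sᵐᵒᵖ A] (p : A →ₗ[(↥T)ᵐᵒᵖ] A) : BTensor T A A →ₗ[Sᵐᵒᵖ] A where
  toFun := BTensor.lift ((AddMonoidHom.mul : A →+ A →+ A).comp p.toAddMonoidHom)
    (fun x t y => by
      change p (op t • x) * y = p x * ((t : A) * y)
      rw [p.map_smul, ← mul_assoc]; rfl)
  map_add' := map_add _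
  map_smul' s z := by
    induction z using BTensor.induction_on with
    | tm a b => exact smul_comm (p a) s b
    | add x y hx hy => rw [smul_add, map_add, map_add, hx, hy, smul_add]

end Mul

/-! ### Coactions of an entwining structure and the maps `a₀ φ(a₁)` and `φ(a₋₁) a₀`. -/

namespace Entwining

section Coaction

variable {R A C : Type*} [Ring R] [Ring A] [Module R A] [Module Rᵐᵒᵖ A]
    [IsRRing R A] [AddCommGroup C] [Module R C] [Module Rᵐᵒᵖ C] [SMulCommClass R Rᵐᵒᵖ C]
    {K : Coring R C} (E : Entwining R A K)

variable (R A C) in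
/-- The action `a ⊗ (a' ⊗ c) ↦ a a' ⊗ c`. -/
def leftAction : BTensor R A (BTensor R A C) →+ BTensor R A C :=
  (BTensor.map (mulHom R A).right LinearMap.id).comp
    (BTensor.assoc R R A A C).symm.toAddMonoidHom

theorem leftAction_tmul (a : A) (y : BTensor R A C) :
    leftAction R A C (BTensor.tmul R a y) = a • y := mul_map_assoc_tmul a y

/-- The right action `(a' ⊗ c) a = a' ψ(c ⊗ a)` of `A` on `A ⊗_R C`. -/
def rightAction (a : A) (y : BTensor R A C) : BTensor R A C :=
  leftAction R A C (BTensor.map LinearMap.id E.psi.left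
    (BTensor.assoc R R A C A (BTensor.tmul R y a)))

theorem rightAction_tmul (a a' : A) (c : C) :
    E.rightAction a (BTensor.tmul R a' c) = a' • E.psi (BTensor.tmul R c a) :=
  leftAction_tmul _ _

theorem rightAction_add (a : A) (y z : BTensor R A C) :
    E.rightAction a (y + z) = E.rightAction a y + E.rightAction a z := by
  simp only [rightAction, BTensor.add_tmul, map_add]

theorem rightAction_smul (a b : A) (y : BTensor R A C) :
    E.rightAction a (b • y) = b • E.rightAction a y := by
  induction y using BTensor.induction_on with
  | tm a' c =>
    rw [BTensor.smul_tmul_left, rightAction_tmul, rightAction_tmul, smul_eq_mul, mul_smul]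
  | add x y hx hy => rw [smul_add, rightAction_add, rightAction_add, hx, hy, smul_add]

/-- The multiplicativity axiom for `ψ`, read as right `A`-linearity of `ϱ`. -/
theorem rightCoaction_mul_eq_rightAction (e : C) (a a' : A) :
    E.rightCoaction e (a * a') = E.rightAction a' (E.rightCoaction e a) :=
  E.psi_mul e a a'

/-- Applying the injective map `ψ` exchanges the two conditions, so both coactions have the same
coinvariants. -/
theorem leftCoaction_eq_iff (hE : Bijective E.psi) (e : C) (a : A) :
    E.leftCoaction hE e a = BTensor.tmul R e a ↔ E.rightCoaction e a = BTensor.tmul R a e := by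
  rw [← hE.1.eq_iff, psi_leftCoaction, eq_comm]
  rfl

theorem psi_comul_apply (z : BTensor R C A) :
    BTensor.map LinearMap.id K.comul.left (E.psi z) =
      BTensor.assoc R R A C C
        (BTensor.map E.psi.right LinearMap.id
          ((BTensor.assoc R R C A C).symm
            (BTensor.map LinearMap.id E.psi.left
              (BTensor.assoc R R C C A
                (BTensor.map K.comul.right LinearMap.id z))))) := by
  induction z using BTensor.induction_on with
  | tm c a => exact E.psi_comul c a
  | add x y hx hy => simp only [map_add, hx, hy]

variable (R A) in
/-- The map `a ↦ a ⊗ e`. -/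
def tmulRight (S : Type*) [Ring S] [Module S A] [SMulCommClass S Rᵐᵒᵖ A] (e : C) :
    A →ₗ[S] BTensor R A C where
  toFun a := BTensor.tmul R a e
  map_add' a b := BTensor.add_tmul a b e
  map_smul' _ _ := rfl

variable (R A) in
/-- The map `a ↦ e ⊗ a`. -/
def tmulLeft (S : Type*) [Ring S] [Module Sᵐᵒᵖ A] [SMulCommClass R Sᵐᵒᵖ A] (e : C) :
    A →ₗ[Sᵐᵒᵖ] BTensor R C A where
  toFun a := BTensor.tmul R e a
  map_add' a b := BTensor.tmul_add e a b
  map_smul' _ _ := rfl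

/-- Coassociativity of `ϱ`: the right side is `ϱ(a₀) ⊗ a₁`. It is the comultiplication axiom for `ψ`
at `e`, with `Δ(e) = e ⊗ e`. -/
theorem map_comul_rightCoaction {e : C} (he : K.IsGrouplike e) (a : A) :
    BTensor.map LinearMap.id K.comul.left (E.rightCoaction e a) =
      BTensor.assoc R R A C C (BTensor.map E.psi.right LinearMap.id
        ((BTensor.assoc R R C A C).symm (BTensor.tmul R e (E.rightCoaction e a)))) := by
  have h := E.psi_comul e a
  rw [he.comul_eq] at h
  exact h

/-- The left coaction is coassociative, in the form obtained by applying `C ⊗ ψ`. -/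
theorem map_comul_leftCoaction (hE : Bijective E.psi) {e : C} (he : K.IsGrouplike e) (a : A) :
    BTensor.map LinearMap.id E.psi.left (BTensor.assoc R R C C A
      (BTensor.map K.comul.right LinearMap.id (E.leftCoaction hE e a))) =
      BTensor.map LinearMap.id (tmulRight R A R e) (E.leftCoaction hE e a) := by
  have hinj : Injective (BTensor.map E.psi.right (LinearMap.id : C →ₗ[R] C)) :=
    (BTensor.congr (LinearEquiv.ofBijective E.psi.right hE) (LinearEquiv.refl R C)).injective
  -- After the injective map `ψ ⊗ C`, the left side becomes `(A ⊗ Δ)(ψ(λ(a)))`, and both sides equal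
  -- `a ⊗ e ⊗ e`.
  apply (BTensor.assoc R R C A C).symm.injective
  apply hinj
  apply (BTensor.assoc R R A C C).injective
  rw [← psi_comul_apply, psi_leftCoaction, BTensor.map_tmul]
  have h : ∀ z : BTensor R C A, BTensor.map E.psi.right (LinearMap.id : C →ₗ[R] C)
      ((BTensor.assoc R R C A C).symm (BTensor.map LinearMap.id (tmulRight R A R e) z)) =
      BTensor.tmul R (E.psi z) e := fun z => by
    induction z using BTensor.induction_on with
    | tm c a => rfl
    | add x y hx hy => simp only [map_add, hx, hy, BTensor.add_tmul]
  rw [h, psi_leftCoaction, BTensor.assoc_tmul]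
  exact congrArg _ he.comul_eq

theorem rid_counit_smul (a : A) (y : BTensor R A C) :
    BTensor.rid R A (BTensor.map LinearMap.id K.counit.left (a • y)) =
      a * BTensor.rid R A (BTensor.map LinearMap.id K.counit.left y) := by
  induction y using BTensor.induction_on with
  | tm b c => exact (IsRRing.mul_op_smul a (K.counit c) b).symm
  | add x y hx hy => simp only [smul_add, map_add, hx, hy, mul_add]

theorem rid_counit_rightCoaction {e : C} (he : K.IsGrouplike e) (a : A) :
    BTensor.rid R A (BTensor.map LinearMap.id K.counit.left (E.rightCoaction e a)) = a := by
  refine (E.psi_counit e a).trans ?_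
  rw [he.counit_eq, one_smul]

/-- The map `a ⊗ c ↦ a φ(c)`. -/
def mulRightMap (φ : C →ₗ[R] A) : BTensor R A C →+ A :=
  (mulHom R A).left.toAddMonoidHom.comp (BTensor.map LinearMap.id φ)

theorem mulRightMap_smul (φ : C →ₗ[R] A) (a : A) (y : BTensor R A C) :
    mulRightMap φ (a • y) = a * mulRightMap φ y := by
  induction y using BTensor.induction_on with
  | tm b c => exact mul_assoc a b (φ c)
  | add x y hx hy => rw [smul_add, map_add, map_add, hx, hy, mul_add]

/-- The map `c ⊗ a ↦ φ(c) a`. -/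
def mulLeftMap (φ : C →ₗ[Rᵐᵒᵖ] A) : BTensor R C A →+ A :=
  (mulHom R A).left.toAddMonoidHom.comp (BTensor.map φ LinearMap.id)

theorem mulLeftMap_op_smul (φ : C →ₗ[Rᵐᵒᵖ] A) {S : Type*} [Ring S] [Module Sᵐᵒᵖ A]
    [SMulCommClass R Sᵐᵒᵖ A] [SMulCommClass A Sᵐᵒᵖ A] (s : Sᵐᵒᵖ) (y : BTensor R C A) :
    mulLeftMap φ (s • y) = s • mulLeftMap φ y := by
  induction y using BTensor.induction_on with
  | tm c b => exact smul_comm (φ c) s b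
  | add x y hx hy => rw [smul_add, map_add, map_add, hx, hy, smul_add]

/-- The hypothesis on `φ` is left colinearity with `ψ` applied. Linearity and coassociativity of `ϱ`
give `ϱ(a₀ φ(a₁)) = a₀ ψ(a₁ ⊗ φ(a₂)) = a₀ φ(a₁) ⊗ e`. -/
theorem rightCoaction_mulRightMap {e : C} (he : K.IsGrouplike e) (φ : C →ₗ[R] A)
    (hφ : ∀ c, E.psi (BTensor.map LinearMap.id φ (K.comul c)) = BTensor.tmul R (φ c) e) (a : A) :
    E.rightCoaction e (mulRightMap φ (E.rightCoaction e a)) =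
      BTensor.tmul R (mulRightMap φ (E.rightCoaction e a)) e := by
  -- `Θ` is `a ⊗ c ⊗ c' ↦ a ψ(c ⊗ φ(c'))`; evaluating it on the two sides of coassociativity gives
  -- the claim.
  let Θ : BTensor R A (BTensor R C C) →+ BTensor R A C :=
    (leftAction R A C).comp
      (BTensor.map LinearMap.id (E.psi.left ∘ₗ BTensor.lTensor C R φ))
  have h0 : ∀ (a : A) (u : BTensor R C C), Θ (BTensor.tmul R a u) =
      a • E.psi (BTensor.map LinearMap.id φ u) := fun a u =>
    leftAction_tmul a (E.psi (BTensor.map LinearMap.id φ u))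
  have h1 : ∀ (v : BTensor R A C) (c : C),
      Θ (BTensor.assoc R R A C C (BTensor.tmul R v c)) = E.rightAction (φ c) v := fun v c => by
    induction v using BTensor.induction_on with
    | tm a c' => rw [BTensor.assoc_tmul, h0, BTensor.map_tmul, rightAction_tmul]; rfl
    | add x y hx hy => rw [BTensor.add_tmul, map_add, map_add, hx, hy, rightAction_add]
  have h2 : ∀ y : BTensor R A C, E.rightCoaction e (mulRightMap φ y) =
      Θ (BTensor.assoc R R A C C (BTensor.map E.psi.right LinearMap.id
        ((BTensor.assoc R R C A C).symm (BTensor.tmul R e y)))) := fun y => by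
    induction y using BTensor.induction_on with
    | tm a c =>
      rw [BTensor.assoc_symm_tmul, BTensor.map_tmul, LinearMap.id_apply, h1]
      exact E.rightCoaction_mul_eq_rightAction e a (φ c)
    | add x y hx hy => simp only [map_add, hx, hy, BTensor.tmul_add]
  have h3 : ∀ y : BTensor R A C, Θ (BTensor.map LinearMap.id K.comul.left y) =
      BTensor.tmul R (mulRightMap φ y) e := fun y => by
    induction y using BTensor.induction_on with
    | tm a c =>
      refine (h0 a (K.comul c)).trans ?_
      rw [hφ]
      rfl
    | add x y hx hy => simp only [map_add, hx, hy, BTensor.add_tmul]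
  rw [h2, ← E.map_comul_rightCoaction he, h3]

/-- For right colinear `φ` one has `ϱ(φ(c) a) = φ(c₁) ψ(c₂ ⊗ a)`; at `λ(a)`, coassociativity of `λ`
turns this into `φ(a₋₁) a₀ ⊗ e`. -/
theorem rightCoaction_mulLeftMap (hE : Bijective E.psi) {e : C} (he : K.IsGrouplike e)
    (φ : C →ₗ[Rᵐᵒᵖ] A)
    (hφ : ∀ c, E.rightCoaction e (φ c) = BTensor.map φ LinearMap.id (K.comul c)) (a : A) :
    E.rightCoaction e (mulLeftMap φ (E.leftCoaction hE e a)) =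
      BTensor.tmul R (mulLeftMap φ (E.leftCoaction hE e a)) e := by
  have h1 : ∀ (v : BTensor R C C) (a : A),
      leftAction R A C (BTensor.map φ LinearMap.id (BTensor.map LinearMap.id E.psi.left
        (BTensor.assoc R R C C A (BTensor.tmul R v a)))) =
      E.rightAction a (BTensor.map φ LinearMap.id v) := fun v a => by
    induction v using BTensor.induction_on with
    | tm c c' => rfl
    | add x y hx hy => simp only [BTensor.add_tmul, map_add, hx, hy, rightAction_add]
  have h2 : ∀ y : BTensor R C A, E.rightCoaction e (mulLeftMap φ y) =
      leftAction R A C (BTensor.map φ LinearMap.id (BTensor.map LinearMap.id E.psi.left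
        (BTensor.assoc R R C C A (BTensor.map K.comul.right LinearMap.id y)))) := fun y => by
    induction y using BTensor.induction_on with
    | tm c a =>
      refine (E.rightCoaction_mul_eq_rightAction e (φ c) a).trans ?_
      rw [hφ, ← h1]
      rfl
    | add x y hx hy => simp only [map_add, hx, hy]
  have h3 : ∀ y : BTensor R C A, leftAction R A C (BTensor.map φ LinearMap.id
      (BTensor.map LinearMap.id (tmulRight R A R e) y)) =
      BTensor.tmul R (mulLeftMap φ y) e := fun y => by
    induction y using BTensor.induction_on with
    | tm c a => exact leftAction_tmul (φ c) _
    | add x y hx hy => simp only [map_add, hx, hy, BTensor.add_tmul]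
  rw [h2, E.map_comul_leftCoaction hE he, h3]

end Coaction

/-! ### Embeddings into `A ⊗_T A` given by a connection, and properties of the lifted canonical map.
-/

section StrongConnection

variable {k R A C : Type*} [CommRing k] [Ring R] [Algebra k R] [Ring A] [Algebra k A]
    [Module R A] [Module Rᵐᵒᵖ A] [IsRRing R A] [IsScalarTower k R A]
    [AddCommGroup C] [Module R C] [Module Rᵐᵒᵖ C] [SMulCommClass R Rᵐᵒᵖ C]
    [Module k C] [IsScalarTower k R C] [IsScalarTower k Rᵐᵒᵖ C]
    {K : Coring R C} {E : Entwining R A K} {e : C} {T : Subalgebra k A}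

section Sections

variable (T) (l : BimodHom R R C (BTensor T A A))

/-- The additive map underlying `smulConnection`. -/
def smulConnectionHom : BTensor R A C →+ BTensor T A A :=
  BTensor.lift
    { toFun := fun a =>
        { toFun := fun c => a • l c
          map_zero' := by rw [map_zero, smul_zero]
          map_add' := fun c c' => by rw [map_add, smul_add] }
      map_zero' := by ext c; exact zero_smul A (l c)
      map_add' := fun a b => by ext c; exact add_smul a b (l c) }
    (fun a r c => by
      change (op r • a) • l c = a • l (r • c)
      rw [l.left.map_smul]
      induction l c using BTensor.induction_on with
      | tm x y => exact congrArg (fun z => BTensor.tmul T z y) (IsRRing.balanced a r x)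
      | add x y hx hy => simp only [smul_add, hx, hy])

theorem smulConnectionHom_tmul (a : A) (c : C) :
    smulConnectionHom T l (BTensor.tmul R a c) = a • l c := rfl

/-- The map `A ⊗_R C → A ⊗_T A`, `a ⊗ c ↦ a ℓ(c)`. -/
def smulConnection : BTensor R A C →ₗ[T] BTensor T A A where
  toFun := smulConnectionHom T l
  map_add' := map_add _
  map_smul' t z := by
    induction z using BTensor.induction_on with
    | tm a c =>
      rw [BTensor.smul_tmul_left, smulConnectionHom_tmul, smulConnectionHom_tmul]
      exact mul_smul (t : A) a (l c)
    | add x y hx hy => rw [smul_add, map_add, map_add, hx, hy, smul_add]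

theorem smulConnection_tmul (a : A) (c : C) :
    smulConnection T l (BTensor.tmul R a c) = a • l c := rfl

/-- The additive map underlying `connectionSMul`. -/
def connectionSMulHom : BTensor R C A →+ BTensor T A A :=
  BTensor.lift
    { toFun := fun c =>
        { toFun := fun a => op a • l c
          map_zero' := by rw [op_zero, zero_smul]
          map_add' := fun a b => by rw [op_add, add_smul] }
      map_zero' := by
        ext a
        change op a • l 0 = 0
        rw [map_zero, smul_zero]
      map_add' := fun c c' => by
        ext a
        change op a • l (c + c') = op a • l c + op a • l c'
        rw [map_add, smul_add] }
    (fun c r a => by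
      change op a • l.right (op r • c) = op (r • a) • l c
      rw [l.right.map_smul]
      change op a • op r • l c = op (r • a) • l c
      induction l c using BTensor.induction_on with
      | tm x y => exact congrArg (fun z => BTensor.tmul T x z) (IsRRing.balanced y r a)
      | add x y hx hy => simp only [smul_add, hx, hy])

theorem connectionSMulHom_tmul (c : C) (a : A) :
    connectionSMulHom T l (BTensor.tmul R c a) = op a • l c := rfl

/-- The map `C ⊗_R A → A ⊗_T A`, `c ⊗ a ↦ ℓ(c) a`. -/
def connectionSMul : BTensor R C A →ₗ[(↥T)ᵐᵒᵖ] BTensor T A A where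
  toFun := connectionSMulHom T l
  map_add' := map_add _
  map_smul' t z := by
    induction z using BTensor.induction_on with
    | tm c a =>
      rw [BTensor.smul_tmul_right, connectionSMulHom_tmul, connectionSMulHom_tmul]
      exact mul_smul (op (t.unop : A)) (op a) (l c)
    | add x y hx hy => rw [smul_add, map_add, map_add, hx, hy, smul_add]

theorem connectionSMul_tmul (c : C) (a : A) :
    connectionSMul T l (BTensor.tmul R c a) = op a • l c := rfl

end Sections

theorem canLift_tmul (hT : T ≤ E.coinvariants k e) (a a' : A) :
    canLift hT (BTensor.tmul T a a') = a • E.rightCoaction e a' := rfl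

theorem canLift_smul (hT : T ≤ E.coinvariants k e) (a : A) (z : BTensor T A A) :
    canLift hT (a • z) = a • canLift hT z := by
  induction z using BTensor.induction_on with
  | tm x y => exact mul_smul a x _
  | add x y hx hy => rw [smul_add, map_add, map_add, hx, hy, smul_add]

theorem canLift_op_smul (hT : T ≤ E.coinvariants k e) (a : A) (z : BTensor T A A) :
    canLift hT (op a • z) = E.rightAction a (canLift hT z) := by
  induction z using BTensor.induction_on with
  | tm x y =>
    rw [BTensor.smul_tmul_right, canLift_tmul, canLift_tmul, rightAction_smul,
      ← rightCoaction_mul_eq_rightAction]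
    rfl
  | add x y hx hy => rw [smul_add, map_add, map_add, hx, hy, rightAction_add]

/-- Since `ϱ` is counital, applying the counit to `x ϱ(y)` leaves the product `x y`. -/
theorem rid_counit_canLift (he : K.IsGrouplike e) (hT : T ≤ E.coinvariants k e)
    (z : BTensor T A A) :
    BTensor.rid R A (BTensor.map LinearMap.id K.counit.left (canLift hT z)) =
      mulApplyRight R (LinearMap.id : A →ₗ[T] A) z := by
  induction z using BTensor.induction_on with
  | tm x y =>
    rw [canLift_tmul, rid_counit_smul, E.rid_counit_rightCoaction he]
    rfl
  | add x y hx hy => simp only [map_add, hx, hy]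

/-- Because `p(y)` is coinvariant and `λ` is right `B`-linear, `λ(x) p(y) = λ(x p(y))`. Thus `x ⊗ y
↦ x p(y)` is left colinear. -/
theorem psi_map_mulApplyRight (hE : Bijective E.psi) (hT : T ≤ E.coinvariants k e)
    {p : A →ₗ[T] A} (hp : ∀ a, p a ∈ E.coinvariants k e) (z : BTensor T A A) :
    E.psi (BTensor.map LinearMap.id (mulApplyRight R p)
      (BTensor.assoc R T C A A (BTensor.map (leftCoactionLin hE hT) LinearMap.id z))) =
      BTensor.tmul R (mulApplyRight R p z) e := by
  induction z using BTensor.induction_on with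
  | tm x y =>
    have h : ∀ u : BTensor R C A, BTensor.map LinearMap.id (mulApplyRight R p)
        (BTensor.assoc R T C A A (BTensor.tmul T u y)) =
        op (⟨p y, hp y⟩ : E.coinvariants k e) • u := fun u => by
      induction u using BTensor.induction_on with
      | tm c a => rfl
      | add x y hx hy => rw [BTensor.add_tmul, map_add, map_add, hx, hy, smul_add]
    rw [BTensor.map_tmul, LinearMap.id_apply, h]
    exact (congrArg E.psi ((leftCoactionLin hE (le_refl (E.coinvariants k e))).map_smul
      (op ⟨p y, hp y⟩) x).symm).trans (E.psi_leftCoaction hE e (x * p y))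
  | add x y hx hy => simp only [map_add, hx, hy, BTensor.add_tmul]

/-- Right colinearity of `x ⊗ y ↦ p(x) y`, from left `B`-linearity of `ϱ`. -/
theorem rightCoaction_mulApplyLeft (hT : T ≤ E.coinvariants k e)
    {p : A →ₗ[(↥T)ᵐᵒᵖ] A} (hp : ∀ a, p a ∈ E.coinvariants k e) (z : BTensor T A A) :
    E.rightCoaction e (mulApplyLeft R p z) =
      BTensor.map (mulApplyLeft R p) LinearMap.id ((BTensor.assoc T R A A C).symm
        (BTensor.map LinearMap.id (rightCoactionLin hT) z)) := by
  induction z using BTensor.induction_on with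
  | tm x y =>
    have h : ∀ u : BTensor R A C, BTensor.map (mulApplyLeft R p) LinearMap.id
        ((BTensor.assoc T R A A C).symm (BTensor.tmul T x u)) = p x • u := fun u => by
      induction u using BTensor.induction_on with
      | tm a c => rfl
      | add x y hx hy => rw [BTensor.tmul_add, map_add, map_add, hx, hy, smul_add]
    rw [BTensor.map_tmul, LinearMap.id_apply, h]
    exact E.rightCoaction_mul e (hp x) y
  | add x y hx hy => simp only [map_add, hx, hy]

/-! ### Consequences of a strong connection: the position of `ℓ(e)` and the two splittings. -/

namespace IsStrongConnection

variable {hE : Bijective E.psi} {hT : T ≤ E.coinvariants k e}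
  {l : BimodHom R R C (BTensor T A A)}

theorem canLift_smulConnection (h : E.IsStrongConnection hE hT l) (z : BTensor R A C) :
    canLift hT (smulConnection T l z) = z := by
  induction z using BTensor.induction_on with
  | tm a c =>
    rw [smulConnection_tmul, canLift_smul, h.canLift_eq, BTensor.smul_tmul_left, smul_eq_mul,
      mul_one]
  | add x y hx hy => rw [map_add, map_add, hx, hy]

theorem canLift_connectionSMul (h : E.IsStrongConnection hE hT l) (z : BTensor R C A) :
    canLift hT (connectionSMul T l z) = E.psi z := by
  induction z using BTensor.induction_on with
  | tm c a =>
    rw [connectionSMul_tmul, canLift_op_smul, h.canLift_eq, rightAction_tmul, one_smul]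
  | add x y hx hy => rw [map_add, map_add, map_add, hx, hy]

theorem mulApplyRight_id_grouplike (h : E.IsStrongConnection hE hT l) (he : K.IsGrouplike e) :
    mulApplyRight R (LinearMap.id : A →ₗ[T] A) (l e) = 1 := by
  rw [← rid_counit_canLift he hT, h.canLift_eq]
  change op (K.counit e) • (1 : A) = 1
  rw [he.counit_eq, op_one, one_smul]

/-- Following the difference by a split injection leaves its kernel unchanged while making `A ⊗_T A`
the codomain. -/
theorem ker_smulConnection_comp (h : E.IsStrongConnection hE hT l) :
    LinearMap.ker (smulConnection T l ∘ₗ (rightCoactionLin hT - tmulRight R A T e)) =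
      asLeft T (E.coinvariants k e) hT := by
  have hi : Injective (smulConnection T l) :=
    LeftInverse.injective h.canLift_smulConnection
  ext a
  rw [LinearMap.mem_ker, LinearMap.comp_apply, map_eq_zero_iff _ hi, LinearMap.sub_apply,
    sub_eq_zero]
  rfl

theorem ker_connectionSMul_comp (h : E.IsStrongConnection hE hT l) :
    LinearMap.ker (connectionSMul T l ∘ₗ (leftCoactionLin hE hT - tmulLeft R A T e)) =
      asRight T (E.coinvariants k e) hT := by
  have hi : Injective (connectionSMul T l) := by
    -- The lifted canonical map carries `ℓ(c) a` to `ψ(c ⊗ a)`, so injectivity comes from that of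
    -- `ψ`.
    refine Injective.of_comp (f := canLift hT) ?_
    rw [funext (f := canLift hT ∘ connectionSMul T l) h.canLift_connectionSMul]
    exact hE.1
  ext a
  rw [LinearMap.mem_ker, LinearMap.comp_apply, map_eq_zero_iff _ hi, LinearMap.sub_apply,
    sub_eq_zero]
  exact E.leftCoaction_eq_iff hE e a

/-- Right colinearity at the grouplike `e` reads `(A ⊗ ϱ)(ℓ(e)) = ℓ(e) ⊗ e`. -/
theorem map_smulConnection_grouplike (h : E.IsStrongConnection hE hT l)
    (he : K.IsGrouplike e) :
    BTensor.map LinearMap.id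
      (smulConnection T l ∘ₗ (rightCoactionLin hT - tmulRight R A T e)) (l e) = 0 := by
  have h1 : ∀ z : BTensor T A A, BTensor.map (LinearMap.id : A →ₗ[(↥T)ᵐᵒᵖ] A)
      (tmulRight R A T e) z = BTensor.assoc T R A A C (BTensor.tmul R z e) := fun z => by
    induction z using BTensor.induction_on with
    | tm x y => rfl
    | add x y hx hy => rw [map_add, BTensor.add_tmul, map_add, hx, hy]
  have h2 : BTensor.map (LinearMap.id : A →ₗ[(↥T)ᵐᵒᵖ] A)
      (rightCoactionLin hT - tmulRight R A T e) (l e) = 0 := by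
    rw [BTensor.map_id_sub, ← h.right_colinear, he.comul_eq, h1, sub_eq_zero]
    rfl
  have h3 := BTensor.map_map (LinearMap.id : A →ₗ[(↥T)ᵐᵒᵖ] A) (smulConnection T l)
    LinearMap.id (rightCoactionLin hT - tmulRight R A T e) (l e)
  rw [h2, map_zero] at h3
  exact h3.symm

theorem map_connectionSMul_grouplike (h : E.IsStrongConnection hE hT l)
    (he : K.IsGrouplike e) :
    BTensor.map (connectionSMul T l ∘ₗ (leftCoactionLin hE hT - tmulLeft R A T e))
      LinearMap.id (l e) = 0 := by
  have h1 : ∀ z : BTensor T A A, BTensor.assoc R T C A A (BTensor.map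
      (tmulLeft R A T e) (LinearMap.id : A →ₗ[T] A) z) = BTensor.tmul R e z := fun z => by
    induction z using BTensor.induction_on with
    | tm x y => rfl
    | add x y hx hy => rw [map_add, BTensor.tmul_add, map_add, hx, hy]
  have h2 : BTensor.map (leftCoactionLin hE hT - tmulLeft R A T e)
      (LinearMap.id : A →ₗ[T] A) (l e) = 0 := by
    rw [BTensor.map_sub_id, sub_eq_zero]
    apply (BTensor.assoc R T C A A).injective
    rw [← h.left_colinear, he.comul_eq, h1]
    rfl
  have h3 := BTensor.map_map (connectionSMul T l) (LinearMap.id : A →ₗ[T] A)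
    (leftCoactionLin hE hT - tmulLeft R A T e) LinearMap.id (l e)
  rw [h2, map_zero] at h3
  exact h3.symm

/-- If `ℓ(e)` comes from `B ⊗_T B` and `B` is a left `T`-direct summand of `A`, then it is a left
`B`-direct summand. -/
theorem isDirectSummand_asLeft (h : E.IsStrongConnection hE hT l) (he : K.IsGrouplike e)
    (hl : ∃ y : BTensor T (asRight T (E.coinvariants k e) hT)
        (asLeft T (E.coinvariants k e) hT),
      BTensor.map (Submodule.subtype _) (Submodule.subtype _) y = l e)
    (hs : IsDirectSummand (asLeft T (E.coinvariants k e) hT)) :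
    IsDirectSummand (asLeft (E.coinvariants k e) (E.coinvariants k e) le_rfl) := by
  obtain ⟨p, hp, hpB⟩ := hs.exists_projection
  obtain ⟨y, hy⟩ := hl
  let φ : C →ₗ[R] A := mulApplyRight R p ∘ₗ l.left
  have hφ : ∀ c, E.psi (BTensor.map LinearMap.id φ (K.comul c)) = BTensor.tmul R (φ c) e :=
    fun c => by
      have h1 := BTensor.map_map (LinearMap.id : C →ₗ[Rᵐᵒᵖ] C) (mulApplyRight R p)
        LinearMap.id l.left (K.comul c)
      rw [h.left_colinear] at h1
      exact (congrArg E.psi h1.symm).trans (psi_map_mulApplyRight hE hT hp (l c))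
  -- The second legs of `ℓ(e)` lie in `B`, where `p` is the identity, so `φ(e)` is the product of
  -- the legs of `ℓ(e)`, that is, `ε(e)·1 = 1`.
  have hφe : φ e = 1 := by
    rw [← h.mulApplyRight_id_grouplike he]
    change mulApplyRight R p (l e) = _
    rw [← hy]
    clear hy
    induction y using BTensor.induction_on with
    | tm a b => exact congrArg (fun z => (a : A) * z) (hpB b b.2)
    | add x y hx hy => rw [map_add, map_add, map_add, hx, hy]
  let f : A →ₗ[E.coinvariants k e] A :=
    { toFun := fun a => mulRightMap φ (E.rightCoaction e a)
      map_add' := fun a b => by rw [map_add, map_add]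
      map_smul' := fun b a =>
        (congrArg _ (E.rightCoaction_mul e b.2 a)).trans (mulRightMap_smul φ (b : A) _) }
  refine .of_projection f (fun a => E.rightCoaction_mulRightMap he φ hφ a) fun b hb => ?_
  change mulRightMap φ (E.rightCoaction e b) = b
  rw [(hb : E.rightCoaction e b = BTensor.tmul R b e)]
  change b * φ e = b
  rw [hφe, mul_one]

/-- If `ℓ(e)` comes from `B ⊗_T B` and `B` is a right `T`-direct summand of `A`, then it is a
right `B`-direct summand. -/
theorem isDirectSummand_asRight (h : E.IsStrongConnection hE hT l) (he : K.IsGrouplike e)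
    (hl : ∃ y : BTensor T (asRight T (E.coinvariants k e) hT)
        (asLeft T (E.coinvariants k e) hT),
      BTensor.map (Submodule.subtype _) (Submodule.subtype _) y = l e)
    (hs : IsDirectSummand (asRight T (E.coinvariants k e) hT)) :
    IsDirectSummand (asRight (E.coinvariants k e) (E.coinvariants k e) le_rfl) := by
  obtain ⟨p, hp, hpB⟩ := hs.exists_projection
  obtain ⟨y, hy⟩ := hl
  let φ : C →ₗ[Rᵐᵒᵖ] A := mulApplyLeft R p ∘ₗ l.right
  have hφ : ∀ c, E.rightCoaction e (φ c) = BTensor.map φ LinearMap.id (K.comul c) :=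
    fun c => by
      have h1 := BTensor.map_map (mulApplyLeft R p) (LinearMap.id : C →ₗ[R] C)
        l.right LinearMap.id (K.comul c)
      refine (rightCoaction_mulApplyLeft hT hp (l c)).trans ?_
      rw [← h.right_colinear, AddEquiv.symm_apply_apply]
      exact h1
  have hφe : φ e = 1 := by
    rw [← h.mulApplyRight_id_grouplike he]
    change mulApplyLeft R p (l e) = _
    rw [← hy]
    clear hy
    induction y using BTensor.induction_on with
    | tm a b => exact congrArg (fun z => z * (b : A)) (hpB a a.2)
    | add x y hx hy => rw [map_add, map_add, map_add, hx, hy]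
  -- The left coaction is used here because it is right `B`-linear.
  let f : A →ₗ[(E.coinvariants k e)ᵐᵒᵖ] A :=
    { toFun := fun a => mulLeftMap φ (E.leftCoaction hE e a)
      map_add' := fun a b => by rw [map_add, map_add]
      map_smul' := fun b a =>
        (congrArg _ ((leftCoactionLin hE (le_refl (E.coinvariants k e))).map_smul b a)).trans
          (mulLeftMap_op_smul φ b _) }
  refine .of_projection f (fun a => E.rightCoaction_mulLeftMap hE he φ hφ a) fun b hb => ?_
  change mulLeftMap φ (E.leftCoaction hE e b) = b
  rw [(E.leftCoaction_eq_iff hE e b).2 hb]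
  change φ e * b = b
  rw [hφe, one_mul]

end IsStrongConnection

end StrongConnection

end Entwining

end EntwinedExt

theorem proposition4 {k : Type u} {R : Type v} {A : Type w} {C : Type x}
    [CommRing k] [Ring R] [Algebra k R]
    [Ring A] [Algebra k A] [Module R A] [Module Rᵐᵒᵖ A] [IsRRing R A]
    [IsScalarTower k R A]
    [AddCommGroup C] [Module R C] [Module Rᵐᵒᵖ C] [SMulCommClass R Rᵐᵒᵖ C]
    [Module k C] [IsScalarTower k R C] [IsScalarTower k Rᵐᵒᵖ C]
    (K : Coring R C) (E : Entwining R A K) (hE : Function.Bijective E.psi)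
    (e : C) (he : K.IsGrouplike e)
    (T : Subalgebra k A) (hT : T ≤ E.coinvariants k e)
    (hconn : ∃ l : BimodHom R R C (BTensor T A A), E.IsStrongConnection hE hT l) :
    (FlatLeft.{w, w, max w x} T A →
      FlatRight.{w, w, max w x} T (asRight T (E.coinvariants k e) hT) →
      IsDirectSummand (asLeft T (E.coinvariants k e) hT) →
      IsDirectSummand (asLeft (E.coinvariants k e) (E.coinvariants k e) le_rfl)) ∧
    (FlatRight.{w, w, max w x} T A →
      FlatLeft.{w, w, max w x} T (asLeft T (E.coinvariants k e) hT) →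
      IsDirectSummand (asRight T (E.coinvariants k e) hT) →
      IsDirectSummand (asRight (E.coinvariants k e) (E.coinvariants k e) le_rfl)) := by
  obtain ⟨l, h⟩ := hconn
  constructor
  · intro hA hB hs
    exact h.isDirectSummand_asLeft he
      (exists_tensor_of_flatLeft hA.of_max hB.of_max h.ker_smulConnection_comp
        h.ker_connectionSMul_comp (h.map_smulConnection_grouplike he)
        (h.map_connectionSMul_grouplike he)) hs
  · intro hA hB hs
    exact h.isDirectSummand_asRight he
      (exists_tensor_of_flatRight hA.of_max hB.of_max h.ker_smulConnection_comp
        h.ker_connectionSMul_comp (h.map_smulConnection_grouplike he)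
        (h.map_connectionSMul_grouplike he)) hs
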